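/- Network creation game: let $V$ be a finite set of $n$ agents and let $\alpha$ be the edge price. Each agent $u$ chooses a strategy $S_u\subseteq V\setminus\{u\}$; the strategy vector $\mathbf s=(S_u)_{u\in V}$ induces the undirected graph $G$ on $V$ in which $x$ and $y$ are adjacent iff $y\in S_x$ or $x\in S_y$. Agent $u$ \emph{buys} the edge $(u,x)$ if $x\in S_u$. The cost of $u$ is $\alpha|S_u|+\sum_{w\in V}d_G(u,w)$ if $G$ is connected, and $\infty$ otherwise. The network $(G,\alpha)$ is \emph{stable} if no agent can strictly decrease her cost by changing her own strategy while all others keep theirs (pure Nash equilibrium). A graph is \emph{biconnected} if it is connected, has at least $3$ vertices and has no vertex whose removal leaves at least two connected components; a \emph{biconnected component} of $G$ is a maximal biconnected induced subgraph of $G$. Vertices $v,u$ form a \emph{critical pair} $\langle v,u\rangle$ of the non-tree network $G$, with associated vertices $v_1,v_2,u'$, if for some biconnected component $H$ of $G$ with $v,u,v_1,v_2,u'\in V(H)$: (1) $v_1\ne v_2$ and $v$ buys the edges $(v,v_1)$ and $(v,v_2)$, neither of which is a bridge of $G$; (2) $u\neq v$, and $u$ buys the edge $(u,u')$, with $u'\ne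 v$; (3) $d_G(v,u)\ge 2$; (4) some shortest path between $v$ and $u$ in $G$ uses the edge $(v,v_1)$; (5) some shortest path between $v$ and $u'$ in $G$ does not use the edge $(u,u')$. \textbf{Lemma.} Let $n\ge 6$ and $\alpha>2n-6$. Every stable network $(G,\alpha)$ with $n$ vertices that is not a tree contains a critical pair $\langle v,u\rangle$, with associated vertices $v_1,v_2,u'$, for which there is moreover a path $P$ between $v$ and $v_2$ in $G$ such that (a) the length of $P$ is at most $2\,d_G(u,v)$ and (b) $P$ uses neither of the edges $(v,v_1)$ and $(v,v_2)$. -/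

import Mathlib

namespace NetworkCreation

noncomputable section

/-- A strategy vector of the network creation game: each agent `u` buys the edges towards the
agents in `S u`, a set of agents different from `u`. -/
structure Profile (V : Type*) where
  S : V → Finset V
  notMem_self : ∀ u, u ∉ S u

namespace Profile

variable {V : Type*}

/-- Agent `u` buys (owns) the edge `(u, x)`. -/
def Buys (s : Profile V) (u x : V) : Prop := x ∈ s.S u

/-- The undirected network `G(s)` induced by a strategy vector. -/
def graph (s : Profile V) : SimpleGraph V where
  Adj x y := s.Buys x y ∨ s.Buys y x
  symm := ⟨fun _ _ h => h.symm⟩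
  loopless := ⟨fun x h => h.elim (s.notMem_self x) (s.notMem_self x)⟩

/-- The strategy vector in which agent `u` plays `T` and everyone else plays as in `s`. -/
def deviate [DecidableEq V] (s : Profile V) (u : V) (T : Finset V) (hT : u ∉ T) : Profile V where
  S := Function.update s.S u T
  notMem_self x := by
    rcases eq_or_ne x u with rfl | hx
    · simpa using hT
    · simpa [Function.update_of_ne hx] using s.notMem_self x

open Classical in
/-- The distance cost of agent `u`: the sum of the distances to all agents, and `∞` in a
disconnected network. -/
def distcost [Fintype V] (s : Profile V) (u : V) : EReal :=
  if s.graph.Connected then (((∑ w : V, s.graph.dist u w : ℕ) : ℝ) : EReal) else ⊤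

/-- The cost of agent `u` for the edge price `α`. -/
def cost [Fintype V] (s : Profile V) (α : ℝ) (u : V) : EReal :=
  ((α * (s.S u).card : ℝ) : EReal) + s.distcost u

/-- The network is in pure Nash equilibrium (stable): no agent can strictly decrease her cost by
unilaterally changing her strategy. -/
def IsStable [Fintype V] [DecidableEq V] (s : Profile V) (α : ℝ) : Prop :=
  ∀ (u : V) (T : Finset V) (hT : u ∉ T), ¬ (s.deviate u T hT).cost α u < s.cost α u

end Profile

variable {V : Type*}

/-- `x` is a cut-vertex of `G`: removing `x` leaves at least two connected components. -/
def IsCutVertex (G : SimpleGraph V) (x : V) : Prop :=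
  Nontrivial (G.induce {y | y ≠ x}).ConnectedComponent

/-- `G` is connected, has at least three vertices and has no cut-vertex. -/
def IsBiconnected (G : SimpleGraph V) : Prop :=
  G.Connected ∧ 3 ≤ Nat.card V ∧ ∀ x, ¬ IsCutVertex G x

/-- The induced subgraph of `G` on the vertex set `H` is a biconnected component of `G`, that is,
a maximal biconnected induced subgraph. -/
def IsBiconnectedComponent (G : SimpleGraph V) (H : Set V) : Prop :=
  Maximal (fun K : Set V => IsBiconnected (G.induce K)) H

/-- A walk is a shortest path between its ends. -/
def IsShortestPath {G : SimpleGraph V} {x y : V} (p : G.Walk x y) : Prop :=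
  p.IsPath ∧ p.length = G.dist x y

/-- `⟨v, u⟩` is a critical pair of the network `G(s)`, with respect to the biconnected component
`H`, witnessed by the vertices `v₁`, `v₂` and `u'`. -/
structure IsCriticalPair (s : Profile V) (H : Set V) (v u v₁ v₂ u' : V) : Prop where
  not_isTree : ¬ s.graph.IsTree
  component : IsBiconnectedComponent s.graph H
  v_mem : v ∈ H
  v₁_mem : v₁ ∈ H
  v₂_mem : v₂ ∈ H
  v₁_ne_v₂ : v₁ ≠ v₂
  buys_v₁ : s.Buys v v₁
  buys_v₂ : s.Buys v v₂
  not_isBridge_v₁ : ¬ s.graph.IsBridge s(v, v₁)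
  not_isBridge_v₂ : ¬ s.graph.IsBridge s(v, v₂)
  u_mem : u ∈ H
  u_ne_v : u ≠ v
  u'_mem : u' ∈ H
  buys_u' : s.Buys u u'
  u'_ne_v : u' ≠ v
  two_le_dist : 2 ≤ s.graph.dist v u
  path_u : ∃ p : s.graph.Walk v u, IsShortestPath p ∧ s(v, v₁) ∈ p.edges
  path_u' : ∃ p : s.graph.Walk v u', IsShortestPath p ∧ s(u, u') ∉ p.edges

end

end NetworkCreation

/-!
Call a cycle isometric if distances along it are distances in the network `G`. A shortest cycle
through an edge that is not a bridge is isometric (`exists_isoCycle`), and in a stable network with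
`α > 2n - 6` isometric cycles are directed: each agent of the cycle buys the edge to her successor
(`Profile.IsStable.directed`). Indeed, suppose that `v` buys both of her edges on the cycle, and
let `u` be the buyer of an edge opposite to `v`. Let `v` replace her two edges by one to `u`, or
let `u` replace her edge by one to `v`. Either one then reaches every agent with at most one step
more than the other one did before. Adding the two equilibrium conditions, the distance costs
cancel and `α ≤ 2(n - 1) - 2 d(u, v) ≤ 2n - 6` remains (`Profile.IsStable.le_of_two_swaps`); the
cycles of length three and four for which `d(u, v) < 2` are excluded by dropping edges, because
`α > n` when `n ≥ 6`.

Granted this, a critical pair arises from any agent `v` that buys two edges `(v, x)` and `(v, y)`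
within one biconnected component `H`. Take isometric cycles through both edges; they lie in `H`.
Let `(v, v₁)` be the edge on the longer cycle, `u` the agent half way round that cycle in the
direction of `v₁`, and `u'` her successor. The shorter cycle without the edge `(v, v₂)` is the path
from `v` to `v₂`; it ends in `v` with an edge that `v` does not buy, so it also avoids `(v, v₁)`.

Such an agent `v` exists. Let `C` be a directed isometric cycle. If two vertices of `C` are joined
by an ear off `C`, then count owners: the ear has more edges than interior vertices, so one of its
interior vertices buys two of its edges or one of its ends buys one of them, besides her edge on
`C` (`Profile.IsStable.exists_buys_two_in_component`). If there is no ear, then `G` consists of `C`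
and of pieces that hang from single vertices of `C`
(`Profile.IsStable.exists_reachable_offCycle`). Let each agent of `C` either drop her edge, or move
it to the next vertex but one, and sum the changes of cost over `C`: the first sum is negative if
`C` has length at most five, the second if it has length at least six.
-/

namespace NetworkCreation

open SimpleGraph

/-! ### Walks, deviations and two simultaneous swaps -/

section Walks

variable {V : Type*} {G : SimpleGraph V}

/-- There is a walk from `x` to `y` of length at most `l` all of whose vertices lie in `A`. -/
def WalkIn (G : SimpleGraph V) (A : Set V) (l : ℕ) (x y : V) : Prop :=
  ∃ p : G.Walk x y, p.length ≤ l ∧ ∀ w ∈ p.support, w ∈ A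

theorem WalkIn.refl {A : Set V} {x : V} (hx : x ∈ A) : WalkIn G A 0 x x :=
  ⟨.nil, by simp, by simpa using hx⟩

theorem WalkIn.trans {A : Set V} {l m : ℕ} {x y z : V} (h : WalkIn G A l x y)
    (h' : WalkIn G A m y z) : WalkIn G A (l + m) x z := by
  obtain ⟨p, hp, hpA⟩ := h
  obtain ⟨q, hq, hqA⟩ := h'
  refine ⟨p.append q, by simp; omega, fun w hw => ?_⟩
  rcases (Walk.mem_support_append_iff _ _).1 hw with hw | hw
  exacts [hpA w hw, hqA w hw]

theorem WalkIn.symm {A : Set V} {l : ℕ} {x y : V} (h : WalkIn G A l x y) : WalkIn G A l y x := by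
  obtain ⟨p, hp, hpA⟩ := h
  exact ⟨p.reverse, by simpa using hp, by simpa using hpA⟩

theorem WalkIn.mono {A B : Set V} {l m : ℕ} {x y : V} (h : WalkIn G A l x y) (hAB : A ⊆ B)
    (hlm : l ≤ m) : WalkIn G B m x y := by
  obtain ⟨p, hp, hpA⟩ := h
  exact ⟨p, hp.trans hlm, fun w hw => hAB (hpA w hw)⟩

theorem WalkIn.of_adj {A : Set V} {x y : V} (h : G.Adj x y) (hx : x ∈ A) (hy : y ∈ A) :
    WalkIn G A 1 x y :=
  ⟨h.toWalk, by simp, by simp [hx, hy]⟩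

theorem WalkIn.dist_le {A : Set V} {l : ℕ} {x y : V} (h : WalkIn G A l x y) : G.dist x y ≤ l := by
  obtain ⟨p, hp, -⟩ := h
  exact (SimpleGraph.dist_le p).trans hp

theorem exists_adj_dist_add_one (hG : G.Connected) {x y : V} (h : x ≠ y) :
    ∃ z, G.Adj x z ∧ G.dist z y + 1 = G.dist x y := by
  obtain ⟨p, hp⟩ := hG.exists_walk_length_eq_dist x y
  cases p with
  | nil => exact (h rfl).elim
  | @cons _ b _ hadj q =>
    refine ⟨_, hadj, le_antisymm ?_ ?_⟩
    · rw [← hp, Walk.length_cons]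
      exact Nat.add_le_add_right (dist_le q) 1
    · obtain ⟨r, hr⟩ := hG.exists_walk_length_eq_dist b y
      rw [← hr]
      exact dist_le (Walk.cons hadj r)

/-- A shortest walk avoids every vertex `a` off the geodesics between its ends. -/
theorem walkIn_dist_of_ne (hG : G.Connected) {x y a : V}
    (h : G.dist x y ≠ G.dist x a + G.dist a y) : WalkIn G {w | w ≠ a} (G.dist x y) x y := by
  classical
  obtain ⟨p, hp⟩ := hG.exists_walk_length_eq_dist x y
  refine ⟨p, hp.le, fun w hw => ?_⟩
  rintro rfl
  apply h
  have h1 := dist_le (p.takeUntil w hw)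
  have h2 := dist_le (p.dropUntil w hw)
  have h3 := congrArg Walk.length (p.take_spec hw)
  have h4 := hG.dist_triangle (u := x) (v := w) (w := y)
  rw [Walk.length_append] at h3
  omega

/-- A shortest walk avoids every vertex `a` that is farther from its end than its start is. -/
theorem walkIn_dist_of_lt (hG : G.Connected) {x y a : V} (h : G.dist x y < G.dist a y) :
    WalkIn G {w | w ≠ a} (G.dist x y) x y :=
  walkIn_dist_of_ne hG (by omega)

/-- A function that grows by at most one along edges is bounded by the distance. -/
theorem le_add_dist_of_lipschitz (hG : G.Connected) (F : V → ℕ)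
    (hF : ∀ x y, G.Adj x y → F y ≤ F x + 1) (x y : V) : F y ≤ F x + G.dist x y := by
  obtain ⟨p, hp⟩ := hG.exists_walk_length_eq_dist x y
  rw [← hp]
  clear hp
  induction p with
  | nil => simp
  | cons h q ih =>
    have := hF _ _ h
    rw [Walk.length_cons]
    omega

end Walks

section Deviations

variable {V : Type*} [DecidableEq V] {s : Profile V} {u x y : V} {T : Finset V} {hT : u ∉ T}

/-- A deviation of `u` keeps every edge except those that `u` bought and gives up. -/
theorem deviate_adj (h : s.graph.Adj x y) (hx : x = u → y ∈ s.S u → y ∈ T)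
    (hy : y = u → x ∈ s.S u → x ∈ T) : (s.deviate u T hT).graph.Adj x y := by
  have key : ∀ a b, s.Buys a b → (a = u → b ∈ s.S u → b ∈ T) →
      (s.deviate u T hT).Buys a b := by
    intro a b hab hb
    by_cases ha : a = u
    · subst ha
      simpa [Profile.Buys, Profile.deviate] using hb rfl hab
    · simpa [Profile.Buys, Profile.deviate, Function.update_of_ne ha] using hab
  rcases h with h | h
  · exact Or.inl (key _ _ h hx)
  · exact Or.inr (key _ _ h hy)

theorem deviate_adj_of_mem (h : x ∈ T) : (s.deviate u T hT).graph.Adj u x :=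
  Or.inl (by simpa [Profile.Buys, Profile.deviate] using h)

theorem walkIn_deviate {A : Set V} {l : ℕ} (h : WalkIn s.graph A l x y) (hA : u ∉ A) :
    WalkIn (s.deviate u T hT).graph Set.univ l x y := by
  obtain ⟨p, hp, hpA⟩ := h
  refine ⟨p.transfer _ fun e he => ?_, by simpa using hp, by simp⟩
  induction e with | h a b =>
  have ha : a ≠ u := fun h => hA (h ▸ hpA a (p.fst_mem_support_of_mem_edges he))
  have hb : b ≠ u := fun h => hA (h ▸ hpA b (p.snd_mem_support_of_mem_edges he))
  exact deviate_adj (p.adj_of_mem_edges he) (fun h => (ha h).elim) fun h => (hb h).elim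

end Deviations

section Stability

variable {V : Type*} [Fintype V] [DecidableEq V] {s : Profile V} {α : ℝ}

theorem Profile.IsStable.connected [Nonempty V] (h : s.IsStable α) : s.graph.Connected := by
  by_contra hc
  obtain ⟨u⟩ := ‹Nonempty V›
  have hT : u ∉ Finset.univ.erase u := by simp
  refine h u (Finset.univ.erase u) hT ?_
  have hc' : (s.deviate u _ hT).graph.Connected := by
    have : ∀ w, (s.deviate u _ hT).graph.Reachable u w := by
      intro w
      rcases eq_or_ne u w with rfl | hw
      · exact .refl _
      · exact (deviate_adj_of_mem (by simp [hw.symm])).reachable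
    exact ⟨fun x y => (this x).symm.trans (this y)⟩
  simp only [Profile.cost, Profile.distcost, hc, hc', if_true, if_false]
  rw [EReal.coe_add_top, ← EReal.coe_add]
  exact EReal.coe_lt_top _

/-- Upper bounds `f` on the distances after a deviation bound the cost before it. -/
theorem Profile.IsStable.cost_le (h : s.IsStable α) (hG : s.graph.Connected) (u : V) (T : Finset V)
    (hT : u ∉ T) (f : V → ℕ)
    (hf : ∀ w, WalkIn (s.deviate u T hT).graph Set.univ (f w) u w) :
    α * (s.S u).card + ∑ w, (s.graph.dist u w : ℝ) ≤ α * T.card + ∑ w, (f w : ℝ) := by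
  have hc' : (s.deviate u T hT).graph.Connected := by
    have : ∀ w, (s.deviate u T hT).graph.Reachable u w := fun w => (hf w).choose.reachable
    exact { preconnected := fun x y => (this x).symm.trans (this y), nonempty := ⟨u⟩ }
  have h1 := h u T hT
  simp only [Profile.cost, Profile.distcost, hG, hc', if_true] at h1
  rw [← EReal.coe_add, ← EReal.coe_add, EReal.coe_lt_coe_iff, not_lt] at h1
  have h2 : ∑ w, ((s.deviate u T hT).graph.dist u w : ℝ) ≤ ∑ w, (f w : ℝ) :=
    Finset.sum_le_sum fun w _ => by exact_mod_cast (hf w).dist_le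
  have h3 : (s.deviate u T hT).S u = T := by simp [Profile.deviate]
  rw [h3] at h1
  push_cast at h1
  linarith

/-- An edge bought from both sides would be dropped by either buyer. -/
theorem Profile.IsStable.not_buys_both (h : s.IsStable α) (hG : s.graph.Connected) (hα : 0 < α) {x y : V}
    (hxy : s.Buys x y) : ¬ s.Buys y x := by
  intro hyx
  have hT : x ∉ (s.S x).erase y := fun h => s.notMem_self x (Finset.mem_of_mem_erase h)
  have := h.cost_le hG x _ hT (s.graph.dist x) fun w => by
    obtain ⟨p, hp⟩ := hG.exists_walk_length_eq_dist x w
    refine ⟨p.transfer _ fun e he => ?_, by simpa using hp.le, by simp⟩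
    induction e with | h a b =>
    have hadj := p.adj_of_mem_edges he
    have hy : (s.deviate x _ hT).graph.Adj x y :=
      Or.inr (by
        have : y ≠ x := fun h => s.notMem_self x (h ▸ hxy)
        simpa [Profile.Buys, Profile.deviate, Function.update_of_ne this] using hyx)
    by_cases h1 : a = x ∧ b = y
    · rw [h1.1, h1.2]; exact hy
    by_cases h2 : a = y ∧ b = x
    · rw [h2.1, h2.2]; exact hy.symm
    · refine deviate_adj hadj (fun ha hb => ?_) (fun hb ha => ?_)
      · exact Finset.mem_erase.2 ⟨fun h => h1 ⟨ha, h⟩, hb⟩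
      · exact Finset.mem_erase.2 ⟨fun h => h2 ⟨h, hb⟩, ha⟩
  rw [Finset.card_erase_of_mem hxy, Nat.cast_sub (Finset.card_pos.2 ⟨y, hxy⟩)] at this
  push_cast at this
  linarith

/-- Agent `a` gives up the edges to `R` and buys the edge to `b`. If `b` reaches every agent of `R`
around `a` by a short enough detour, then all distances from `a` become at most one more than
those from `b`. -/
theorem Profile.IsStable.swap_le (h : s.IsStable α) (hG : s.graph.Connected) (hα : 0 < α) {a b : V}
    (hab : a ≠ b) {R : Finset V} (hR : R ⊆ s.S a)
    (hd : ∀ r ∈ R, WalkIn s.graph {w | w ≠ a} (s.graph.dist a b + 1) b r) :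
    α * R.card + ∑ w, (s.graph.dist a w : ℝ) + s.graph.dist a b + 1 ≤
      α + Fintype.card V + ∑ w, (s.graph.dist b w : ℝ) := by
  have hT : a ∉ insert b (s.S a \ R) := by
    simp only [Finset.mem_insert, Finset.mem_sdiff, not_or, not_and]
    exact ⟨hab, fun h => (s.notMem_self a h).elim⟩
  let G' := (s.deviate a _ hT).graph
  have hab' : WalkIn G' Set.univ 1 a b :=
    .of_adj (deviate_adj_of_mem (by simp)) trivial trivial
  have key := h.cost_le hG a _ hT (fun w => if w = a then 0 else s.graph.dist b w + 1) fun w => by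
    by_cases hw : w = a
    · simp only [hw, if_true]
      exact .refl trivial
    simp only [hw, if_false]
    by_cases h1 : s.graph.dist b w = s.graph.dist b a + s.graph.dist a w
    · obtain ⟨z, hz, hzd⟩ := exists_adj_dist_add_one hG (Ne.symm hw)
      have hzw : WalkIn G' Set.univ (s.graph.dist z w) z w :=
        walkIn_deviate (walkIn_dist_of_lt hG (a := a) (by omega)) (by simp)
      have hba := dist_comm (G := s.graph) (u := a) (v := b)
      by_cases hzR : z ∈ R
      · have := (hab'.trans (walkIn_deviate (hd z hzR) (by simp))).trans hzw
        exact this.mono subset_rfl (by omega)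
      · have haz : G'.Adj a z := deviate_adj hz
          (fun _ hz => Finset.mem_insert_of_mem (Finset.mem_sdiff.2 ⟨hz, hzR⟩))
          (fun h => (hz.ne h.symm).elim)
        exact ((WalkIn.of_adj (A := Set.univ) haz trivial trivial).trans hzw).mono subset_rfl (by omega)
    · have := hab'.trans (walkIn_deviate (walkIn_dist_of_ne hG h1) (by simp))
      exact this.mono subset_rfl (by omega)
  have hcard : ((insert b (s.S a \ R)).card : ℝ) ≤ (s.S a).card - R.card + 1 := by
    have h1 := Finset.card_insert_le b (s.S a \ R)
    have h2 := Finset.card_sdiff_add_card_eq_card hR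
    have h3 : (insert b (s.S a \ R)).card + R.card ≤ (s.S a).card + 1 := by omega
    have h4 : ((insert b (s.S a \ R)).card : ℝ) + R.card ≤ (s.S a).card + 1 := by exact_mod_cast h3
    linarith
  have hsum : ∑ w, ((if w = a then 0 else s.graph.dist b w + 1 : ℕ) : ℝ) + s.graph.dist a b + 1 =
      Fintype.card V + ∑ w, (s.graph.dist b w : ℝ) := by
    have h1 : ∑ w, (s.graph.dist b w + 1 : ℝ) =
        ∑ w, ((if w = a then 0 else s.graph.dist b w + 1 : ℕ) : ℝ) + (s.graph.dist b a + 1) := by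
      rw [← Finset.sum_erase_add _ _ (Finset.mem_univ a),
        ← Finset.sum_erase_add (a := a) (f := fun w => ((if w = a then 0 else _ : ℕ) : ℝ)) _
          (Finset.mem_univ a)]
      simp only [if_true, Nat.cast_zero, add_zero]
      congr 1
      refine Finset.sum_congr rfl fun w hw => ?_
      rw [if_neg (Finset.ne_of_mem_erase hw)]
      push_cast
      rfl
    rw [Finset.sum_add_distrib] at h1
    simp only [Finset.sum_const, Finset.card_univ, nsmul_eq_mul, mul_one] at h1
    rw [dist_comm (u := a)]
    linarith
  have := mul_le_mul_of_nonneg_left hcard hα.le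
  linarith

/-- Two far apart agents `v` and `u` that could each replace edges of their own by an edge to the
other, `v` getting rid of two edges and `u` of one, force the edge price to be small: the sum of
the two changes of distance costs is bounded independently of the network. -/
theorem Profile.IsStable.le_of_two_swaps (h : s.IsStable α) (hG : s.graph.Connected) (hα : 0 < α)
    {v u v₁ v₂ u' : V} (hv : v₁ ≠ v₂) (h₁ : s.Buys v v₁) (h₂ : s.Buys v v₂) (h' : s.Buys u u')
    (hd : 2 ≤ s.graph.dist v u)
    (w₁ : WalkIn s.graph {w | w ≠ v} (s.graph.dist v u + 1) u v₁)
    (w₂ : WalkIn s.graph {w | w ≠ v} (s.graph.dist v u + 1) u v₂)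
    (w' : WalkIn s.graph {w | w ≠ u} (s.graph.dist v u + 1) v u') :
    α ≤ 2 * Fintype.card V - 6 := by
  have hvu : v ≠ u := by rintro rfl; simp at hd
  have k1 := h.swap_le hG hα (a := v) (b := u) (R := {v₁, v₂}) hvu
    (by
      intro r hr
      rcases Finset.mem_insert.1 hr with rfl | hr
      · exact h₁
      · rw [Finset.mem_singleton.1 hr]; exact h₂)
    (by
      intro r hr
      rcases Finset.mem_insert.1 hr with rfl | hr
      · exact w₁
      · rw [Finset.mem_singleton.1 hr]; exact w₂)
  have k2 := h.swap_le hG hα (a := u) (b := v) (R := {u'}) hvu.symm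
    (by
      intro r hr
      rw [Finset.mem_singleton.1 hr]; exact h')
    (by
      intro r hr
      rw [Finset.mem_singleton.1 hr, dist_comm]; exact w')
  rw [Finset.card_pair hv] at k1
  rw [Finset.card_singleton, dist_comm (u := u)] at k2
  have : (2 : ℝ) ≤ s.graph.dist v u := by exact_mod_cast hd
  push_cast at k1 k2
  linarith

end Stability

/-! ### Isometric cycles -/

section IsoCycles

variable {V : Type*} {G : SimpleGraph V} {k : ℕ} {c : ℤ → V}

/-- `c` runs periodically through an isometric cycle of length `k` of `G`: distances along the
cycle are distances in `G`. In particular the cycle is injective modulo `k`. -/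
structure IsoCycle (G : SimpleGraph V) (k : ℕ) (c : ℤ → V) : Prop where
  three_le : 3 ≤ k
  periodic : ∀ i, c (i + k) = c i
  adj : ∀ i, G.Adj (c i) (c (i + 1))
  dist_eq : ∀ (i : ℤ) (t : ℕ), t ≤ k → G.dist (c i) (c (i + t)) = min t (k - t)

namespace IsoCycle

theorem shift (hc : IsoCycle G k c) (a : ℤ) : IsoCycle G k fun i => c (i + a) where
  three_le := hc.three_le
  periodic i := by rw [add_right_comm]; exact hc.periodic _
  adj i := by rw [add_right_comm]; exact hc.adj _
  dist_eq i t ht := by rw [add_right_comm]; exact hc.dist_eq _ _ ht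

theorem congr_mod (hc : IsoCycle G k c) {i j : ℤ} (h : (k : ℤ) ∣ j - i) : c i = c j := by
  obtain ⟨m, hm⟩ := h
  have hp : Function.Periodic c (k : ℤ) := hc.periodic
  have := hp.int_mul m i
  rw [← this]
  congr 1
  simp only [Int.cast_id]
  linarith

theorem ne (hc : IsoCycle G k c) {i j : ℤ} (h : i < j) (h' : j < i + k) : c i ≠ c j := by
  intro he
  have h1 := hc.dist_eq i (j - i).toNat (by omega)
  rw [show i + ((j - i).toNat : ℤ) = j by omega, he, SimpleGraph.dist_self] at h1
  omega

theorem eq_iff (hc : IsoCycle G k c) {i j : ℤ} : c i = c j ↔ (k : ℤ) ∣ j - i := by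
  refine ⟨fun h => ?_, hc.congr_mod⟩
  have hk : (0 : ℤ) < k := by have := hc.three_le; omega
  by_contra hd
  have h1 := Int.emod_nonneg (j - i) hk.ne'
  have h2 := Int.emod_lt_of_pos (j - i) hk
  have h3 : (j - i) % k ≠ 0 := fun h => hd (Int.dvd_of_emod_eq_zero h)
  refine hc.ne (i := i) (j := i + (j - i) % k) (by omega) (by omega) ?_
  rw [h]
  refine (hc.congr_mod ?_).symm
  have := Int.emod_add_mul_ediv (j - i) k
  exact ⟨(j - i) / k, by linarith⟩

/-- The arc of length `t` that starts at position `i`. -/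
theorem exists_arc (hc : IsoCycle G k c) (t : ℕ) : ∀ i j : ℤ, j = i + t →
    ∃ p : G.Walk (c i) (c j), p.length = t ∧
      (∀ w, w ∈ p.support ↔ ∃ n : ℕ, n ≤ t ∧ w = c (i + n)) ∧
      (∀ e, e ∈ p.edges ↔ ∃ n : ℕ, n < t ∧ e = s(c (i + n), c (i + n + 1))) ∧
      (t < k → p.IsPath) := by
  induction t with
  | zero =>
    intro i j h
    obtain rfl : j = i := by simpa using h
    refine ⟨.nil, rfl, fun w => ?_, fun e => by simp, fun _ => .nil⟩
    simp
  | succ t ih =>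
    intro i j h
    obtain ⟨p, hl, hs, he, hp⟩ := ih (i + 1) j (by push_cast at h; omega)
    refine ⟨.cons (hc.adj i) p, by simp [hl], fun w => ?_, fun e => ?_, fun ht => ?_⟩
    · rw [Walk.support_cons, List.mem_cons, hs]
      constructor
      · rintro (rfl | ⟨n, hn, rfl⟩)
        · exact ⟨0, by simp, by simp⟩
        · exact ⟨n + 1, by omega, by congr 1; push_cast; ring⟩
      · rintro ⟨n, hn, rfl⟩
        rcases n with _ | n
        · left; simp
        · exact Or.inr ⟨n, by omega, by congr 1; push_cast; ring⟩
    · rw [Walk.edges_cons, List.mem_cons, he]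
      constructor
      · rintro (rfl | ⟨n, hn, rfl⟩)
        · exact ⟨0, by simp, by simp⟩
        · refine ⟨n + 1, by omega, ?_⟩
          rw [show i + ((n + 1 : ℕ) : ℤ) = i + 1 + n by push_cast; ring]
      · rintro ⟨n, hn, rfl⟩
        rcases n with _ | n
        · left; simp
        · refine Or.inr ⟨n, by omega, ?_⟩
          rw [show i + ((n + 1 : ℕ) : ℤ) = i + 1 + n by push_cast; ring]
    · rw [Walk.cons_isPath_iff]
      refine ⟨hp (by omega), fun h => ?_⟩
      obtain ⟨n, hn, hn'⟩ := (hs _).1 h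
      exact hc.ne (by omega) (by omega) hn'

/-- An arc avoids every position outside of it. -/
theorem walkIn_arc (hc : IsoCycle G k c) {i j a : ℤ} {l : ℕ} (hij : i ≤ j) (hl : j - i ≤ l)
    (ha : a < i) (ha' : j < a + k) : WalkIn G {w | w ≠ c a} l (c i) (c j) := by
  obtain ⟨p, hp, hs, -⟩ := hc.exists_arc (j - i).toNat i j (by omega)
  refine ⟨p, by omega, fun w hw => ?_⟩
  obtain ⟨n, hn, rfl⟩ := (hs w).1 hw
  exact (hc.ne (by omega) (by omega)).symm

/-- It suffices to bound the distances between positions `0, …, k - 1` from below. -/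
theorem of_le_dist (hG : G.Connected) (hk : 3 ≤ k) (hp : ∀ i, c (i + k) = c i)
    (ha : ∀ i, G.Adj (c i) (c (i + 1)))
    (hd : ∀ i j : ℕ, i ≤ j → j < k → min (j - i) (k - (j - i)) ≤ G.dist (c i) (c j)) :
    IsoCycle G k c := by
  refine ⟨hk, hp, ha, fun i t ht => ?_⟩
  have hper : Function.Periodic c (k : ℤ) := hp
  have hup : ∀ (t : ℕ) (i : ℤ), G.dist (c i) (c (i + t)) ≤ t := by
    intro t
    induction t with
    | zero => simp
    | succ t ih =>
      intro i
      have h1 := hG.dist_triangle (u := c i) (v := c (i + t)) (w := c (i + (t + 1 : ℕ)))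
      have h2 : G.dist (c (i + t)) (c (i + (t + 1 : ℕ))) = 1 := by
        rw [dist_eq_one_iff_adj]
        have := ha (i + t)
        rwa [add_assoc] at this
      have := ih i
      omega
  apply le_antisymm
  · refine le_min (hup t i) ?_
    have := hup (k - t) (i + t)
    rwa [show i + t + ((k - t : ℕ) : ℤ) = i + k by omega, hp, dist_comm] at this
  · have hk0 : (0 : ℤ) < k := by omega
    have h1 := Int.emod_nonneg i hk0.ne'
    have h2 := Int.emod_lt_of_pos i hk0
    obtain ⟨r, hr⟩ := Int.eq_ofNat_of_zero_le h1
    have hi : ∀ x : ℤ, c (i + x) = c (r + x) := by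
      intro x
      have := hper.int_mul (i / k) (r + x)
      rw [← this]
      congr 1
      have := Int.emod_add_mul_ediv i k
      simp only [Int.cast_id]
      linarith
    have hi0 := hi 0
    rw [add_zero, add_zero] at hi0
    rw [hi0, hi]
    rcases eq_or_lt_of_le ht with rfl | ht
    · simp
    rcases lt_or_ge (r + t) k with h | h
    · have := hd r (r + t) (by omega) h
      push_cast at this
      rwa [Nat.add_sub_cancel_left] at this
    · have := hd (r + t - k) r (by omega) (by omega)
      rw [show (((r + t - k : ℕ)) : ℤ) = r + t - k by omega, dist_comm, hper.sub_eq] at this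
      omega

end IsoCycle

/-- Every edge `(a, b)` that is not a bridge lies on an isometric cycle, namely on a shortest cycle
through it. -/
theorem exists_isoCycle (hG : G.Connected) {a b : V} (hab : G.Adj a b)
    (hbr : ¬ G.IsBridge s(a, b)) : ∃ (k : ℕ) (c : ℤ → V), IsoCycle G k c ∧ c 0 = a ∧ c 1 = b := by
  set G' := G.deleteEdges {s(a, b)} with hG'
  have hc' : G'.Connected := hG.connected_delete_edge_of_not_isBridge hbr
  have hadj : ∀ x y, G.Adj x y → ¬ G'.Adj x y → x = a ∧ y = b ∨ x = b ∧ y = a := by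
    intro x y h h'
    by_contra hne
    apply h'
    rw [hG', deleteEdges_adj]
    refine ⟨h, fun h => hne ?_⟩
    simpa using h
  obtain ⟨p, hp⟩ := hc'.exists_walk_length_eq_dist b a
  set L := p.length with hL
  have h2 : 2 ≤ L := by
    rw [hp]
    refine hc'.one_lt_dist_of_ne_of_not_adj hab.ne.symm ?_
    simp [hG', Sym2.eq_swap]
  let c : ℤ → V := fun i => p.getVert (i % ((L + 1 : ℕ) : ℤ)).toNat
  have hcn : ∀ i : ℕ, i ≤ L → c i = p.getVert i := by
    intro i hi
    simp only [c]
    congr 1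
    rw [Int.emod_eq_of_lt (by omega) (by omega)]
    simp
  have hb : ∀ i : ℕ, i ≤ L → G'.dist b (p.getVert i) ≤ i := fun i hi => by
    have := dist_le (p.take i)
    rwa [Walk.take_length, min_eq_left hi] at this
  have ha : ∀ i : ℕ, i ≤ L → G'.dist (p.getVert i) a ≤ L - i := fun i hi => by
    have := dist_le (p.drop i)
    rwa [Walk.drop_length] at this
  have hiso : IsoCycle G (L + 1) c := by
    refine .of_le_dist hG (by omega) (fun i => by simp [c]) (fun i => ?_) fun i j hij hj => ?_
    · have h0 := Int.emod_nonneg i (b := ((L + 1 : ℕ) : ℤ)) (by omega)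
      have h1 := Int.emod_lt_of_pos i (b := ((L + 1 : ℕ) : ℤ)) (by omega)
      rcases lt_or_ge ((i % ((L + 1 : ℕ) : ℤ)).toNat) L with h | h
      · have h3 : ((i + 1) % ((L + 1 : ℕ) : ℤ)).toNat = (i % ((L + 1 : ℕ) : ℤ)).toNat + 1 := by
          rw [Int.add_emod, Int.emod_eq_of_lt (a := 1) (by omega) (by omega),
            Int.emod_eq_of_lt (by omega) (by omega)]
          omega
        simp only [c]
        rw [h3]
        have := p.adj_getVert_succ h
        exact (deleteEdges_le _) this
      · have h4 : (i % ((L + 1 : ℕ) : ℤ)) = L := by omega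
        have h3 : ((i + 1) % ((L + 1 : ℕ) : ℤ)) = 0 := by
          rw [Int.add_emod, Int.emod_eq_of_lt (a := 1) (by omega) (by omega), h4]
          simp
        simp only [c]
        rw [h3, h4]
        simpa [hL] using hab
    · rw [hcn i (by omega), hcn j (by omega)]
      set x := p.getVert i
      set y := p.getVert j
      -- A walk from `x` to `y` either stays in `G'` or crosses the edge `(a, b)`.
      have key := le_add_dist_of_lipschitz hG
        (fun z => min (G'.dist z y) (min (G'.dist z a + 1 + G'.dist b y)
          (G'.dist z b + 1 + G'.dist a y))) (fun z w hzw => by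
            by_cases h : G'.Adj z w
            · have h1 : ∀ q, G'.dist w q ≤ G'.dist z q + 1 := fun q => by
                have := hc'.dist_triangle (u := w) (v := z) (w := q)
                rw [dist_eq_one_iff_adj.2 h.symm] at this
                omega
              have := h1 y
              have := h1 a
              have := h1 b
              omega
            · rcases hadj z w hzw h with ⟨rfl, rfl⟩ | ⟨rfl, rfl⟩
              · simp only [SimpleGraph.dist_self]
                omega
              · simp only [SimpleGraph.dist_self]
                omega) y x
      simp only [SimpleGraph.dist_self, Nat.zero_min, zero_add] at key
      have e1 := hb i (by omega)
      have e2 := hb j (by omega)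
      have e3 := ha i (by omega)
      have e4 := ha j (by omega)
      have t1 := hc'.dist_triangle (u := b) (v := x) (w := a)
      have t2 := hc'.dist_triangle (u := b) (v := y) (w := a)
      have t3 := hc'.dist_triangle (u := b) (v := x) (w := y)
      have t4 : G'.dist x b = G'.dist b x := dist_comm
      have t5 : G'.dist a y = G'.dist y a := dist_comm
      have t6 : G.dist x y = G.dist y x := dist_comm
      change G'.dist b x ≤ i at e1
      change G'.dist b y ≤ j at e2
      change G'.dist x a ≤ _ at e3
      change G'.dist y a ≤ _ at e4
      omega
  refine ⟨L + 1, fun i => c (i + -1), hiso.shift _, ?_, ?_⟩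
  · have : c (0 + -1) = c L := hiso.congr_mod ⟨1, by push_cast; ring⟩
    simp only [this]
    rw [hcn L le_rfl]
    simp [hL]
  · have := hcn 0 (by omega)
    simpa using this

end IsoCycles

/-! ### Isometric cycles are directed -/

section DirectedCycles

variable {V : Type*} [Fintype V] [DecidableEq V] {s : Profile V} {α : ℝ}

open Classical in
/-- Agent `x` gives up the edge to `y` and detours: only the distances to those agents suffer for
which `y` is the only first step of a shortest walk. -/
theorem Profile.IsStable.le_of_detour (h : s.IsStable α) (hG : s.graph.Connected) {x y : V}
    (hxy : s.Buys x y) (hT : x ∉ (s.S x).erase y) (L : ℕ)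
    (hd : WalkIn (s.deviate x _ hT).graph Set.univ (L + 1) x y) :
    α ≤ L * ({w | w ≠ x ∧ ∀ z, s.graph.Adj x z → s.graph.dist z w + 1 = s.graph.dist x w → z = y} :
      Finset V).card := by
  set A : Finset V :=
    {w | w ≠ x ∧ ∀ z, s.graph.Adj x z → s.graph.dist z w + 1 = s.graph.dist x w → z = y} with hA
  have key := h.cost_le hG x _ hT (fun w => s.graph.dist x w + if w ∈ A then L else 0) fun w => by
    by_cases hw : w = x
    · subst hw
      exact (WalkIn.refl (Set.mem_univ _)).mono subset_rfl (Nat.zero_le _)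
    obtain ⟨z, hz, hzd⟩ := exists_adj_dist_add_one hG (Ne.symm hw)
    have hzw : ∀ z, s.graph.dist z w + 1 = s.graph.dist x w →
        WalkIn (s.deviate x _ hT).graph Set.univ (s.graph.dist z w) z w := fun z hzd =>
      walkIn_deviate (walkIn_dist_of_lt hG (a := x) (by omega)) (by simp)
    by_cases hwA : w ∈ A
    · rw [if_pos hwA]
      obtain rfl : z = y := (Finset.mem_filter.1 hwA).2.2 z hz hzd
      exact (hd.trans (hzw z hzd)).mono subset_rfl (by omega)
    · rw [if_neg hwA]
      have : ∃ z, s.graph.Adj x z ∧ s.graph.dist z w + 1 = s.graph.dist x w ∧ z ≠ y := by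
        by_contra hcon
        push Not at hcon
        exact hwA (Finset.mem_filter.2 ⟨Finset.mem_univ _, hw, hcon⟩)
      obtain ⟨z, hz, hzd, hzy⟩ := this
      have haz : (s.deviate x _ hT).graph.Adj x z := deviate_adj hz
        (fun _ h => Finset.mem_erase.2 ⟨hzy, h⟩) (fun h => (hz.ne h.symm).elim)
      exact ((WalkIn.of_adj (A := Set.univ) haz (Set.mem_univ _) (Set.mem_univ _)).trans (hzw z hzd)).mono
        subset_rfl (by omega)
  rw [Finset.card_erase_of_mem hxy, Nat.cast_sub (Finset.card_pos.2 ⟨y, hxy⟩)] at key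
  push_cast at key
  rw [Finset.sum_add_distrib] at key
  simp only [Finset.sum_ite_mem, Finset.univ_inter, Finset.sum_const, nsmul_eq_mul] at key
  linarith

/-- A buyer would drop an edge of a triangle. -/
theorem Profile.IsStable.le_of_triangle (h : s.IsStable α) (hG : s.graph.Connected) {x y z : V}
    (hxy : s.Buys x y) (hxz : s.graph.Adj x z) (hzy : s.graph.Adj z y) :
    α ≤ Fintype.card V := by
  classical
  have hT : x ∉ (s.S x).erase y := fun h => s.notMem_self x (Finset.mem_of_mem_erase h)
  have hxy' : x ≠ y := fun h => s.notMem_self x (h ▸ hxy)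
  have h1 : (s.deviate x _ hT).graph.Adj x z := deviate_adj hxz
    (fun _ h => Finset.mem_erase.2 ⟨hzy.ne, h⟩) (fun h => (hxz.ne h.symm).elim)
  have h2 : (s.deviate x _ hT).graph.Adj z y := deviate_adj hzy
    (fun h => (hxz.ne h.symm).elim) (fun h => (hxy' h.symm).elim)
  have key := h.le_of_detour hG hxy hT 1
    ((WalkIn.of_adj h1 (Set.mem_univ _) (Set.mem_univ _)).trans (.of_adj h2 (Set.mem_univ _) (Set.mem_univ _)))
  rw [Nat.cast_one, one_mul] at key
  exact key.trans (by exact_mod_cast Finset.card_le_univ _)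

/-- On a cycle of length four with two consecutive edges `(a, b)` and `(b, c)` bought by `a` and
`b`, no agent makes both of these edges indispensable for their buyers. -/
theorem Profile.IsStable.le_of_four_cycle (h : s.IsStable α) (hG : s.graph.Connected)
    {a b c d : V} (hab : s.Buys a b) (hbc : s.Buys b c) (hcd : s.graph.Adj c d)
    (hda : s.graph.Adj d a) (hac : a ≠ c) (hbd : b ≠ d) : α ≤ Fintype.card V := by
  classical
  have hTa : a ∉ (s.S a).erase b := fun h => s.notMem_self a (Finset.mem_of_mem_erase h)
  have hTb : b ∉ (s.S b).erase c := fun h => s.notMem_self b (Finset.mem_of_mem_erase h)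
  have gab : s.graph.Adj a b := Or.inl hab
  have gbc : s.graph.Adj b c := Or.inl hbc
  have a1 : (s.deviate a _ hTa).graph.Adj a d := deviate_adj hda.symm
    (fun _ h => Finset.mem_erase.2 ⟨hbd.symm, h⟩) (fun h => (hda.ne h).elim)
  have a2 : (s.deviate a _ hTa).graph.Adj d c := deviate_adj hcd.symm
    (fun h => (hda.ne h).elim) (fun h => (hac h.symm).elim)
  have a3 : (s.deviate a _ hTa).graph.Adj c b := deviate_adj gbc.symm
    (fun h => (hac h.symm).elim) (fun h => (gab.ne h.symm).elim)
  have b1 : (s.deviate b _ hTb).graph.Adj b a := deviate_adj gab.symm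
    (fun _ h => Finset.mem_erase.2 ⟨hac, h⟩) (fun h => (gab.ne h).elim)
  have b2 : (s.deviate b _ hTb).graph.Adj a d := deviate_adj hda.symm
    (fun h => (gab.ne h).elim) (fun h => (hbd h.symm).elim)
  have b3 : (s.deviate b _ hTb).graph.Adj d c := deviate_adj hcd.symm
    (fun h => (hbd h.symm).elim) (fun h => (gbc.ne h.symm).elim)
  have k1 := h.le_of_detour hG hab hTa 2 (((WalkIn.of_adj a1 (Set.mem_univ _) (Set.mem_univ _)).trans
    (.of_adj a2 (Set.mem_univ _) (Set.mem_univ _))).trans (.of_adj a3 (Set.mem_univ _) (Set.mem_univ _)))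
  have k2 := h.le_of_detour hG hbc hTb 2 (((WalkIn.of_adj b1 (Set.mem_univ _) (Set.mem_univ _)).trans
    (.of_adj b2 (Set.mem_univ _) (Set.mem_univ _))).trans (.of_adj b3 (Set.mem_univ _) (Set.mem_univ _)))
  have hdisj : Disjoint
      ({w | w ≠ a ∧ ∀ z, s.graph.Adj a z → s.graph.dist z w + 1 = s.graph.dist a w → z = b} :
        Finset V)
      ({w | w ≠ b ∧ ∀ z, s.graph.Adj b z → s.graph.dist z w + 1 = s.graph.dist b w → z = c} :
        Finset V) := by
    rw [Finset.disjoint_left]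
    intro w hwa hwb
    obtain ⟨ha, ha'⟩ := (Finset.mem_filter.1 hwa).2
    obtain ⟨hb, hb'⟩ := (Finset.mem_filter.1 hwb).2
    obtain ⟨x, hx, hxd⟩ := exists_adj_dist_add_one hG (Ne.symm ha)
    obtain ⟨y, hy, hyd⟩ := exists_adj_dist_add_one hG (Ne.symm hb)
    obtain rfl := ha' x hx hxd
    obtain rfl := hb' y hy hyd
    have h1 := hG.dist_triangle (u := d) (v := y) (w := w)
    have h2 := hG.dist_triangle (u := a) (v := d) (w := w)
    rw [dist_eq_one_iff_adj.2 hcd.symm] at h1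
    rw [dist_eq_one_iff_adj.2 hda.symm] at h2
    exact hbd (ha' d hda.symm (by omega)).symm
  have hcard := Finset.card_union_of_disjoint hdisj
  have hle := Finset.card_le_univ (
      ({w | w ≠ a ∧ ∀ z, s.graph.Adj a z → s.graph.dist z w + 1 = s.graph.dist a w → z = b} :
        Finset V) ∪
      ({w | w ≠ b ∧ ∀ z, s.graph.Adj b z → s.graph.dist z w + 1 = s.graph.dist b w → z = c} :
        Finset V))
  rw [hcard] at hle
  have hle' := (Nat.cast_le (α := ℝ)).2 hle
  push_cast at hle' k1 k2
  linarith

theorem Profile.IsStable.four_le (h : s.IsStable α) (hG : s.graph.Connected)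
    (hα : Fintype.card V < α) {k : ℕ} {c : ℤ → V} (hc : IsoCycle s.graph k c) : 4 ≤ k := by
  by_contra hk
  obtain rfl : k = 3 := by have := hc.three_le; omega
  have h0 := hc.adj 0
  have h1 := hc.adj 1
  have h2 := hc.adj 2
  have h3 : c (2 + 1) = c 0 := hc.periodic 0
  rw [h3] at h2
  norm_num at h0 h1 h2
  rcases h0 with hb | hb
  · exact absurd (h.le_of_triangle hG hb h2.symm h1.symm) (not_le.2 hα)
  · exact absurd (h.le_of_triangle hG hb h1 h2) (not_le.2 hα)

/-- No agent buys both of her edges on an isometric cycle: otherwise she and the buyer of an edge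
opposite to her could swap as in `Profile.IsStable.le_of_two_swaps`. -/
theorem Profile.IsStable.not_buys_two_on_isoCycle (h : s.IsStable α) (hG : s.graph.Connected)
    (hn : 6 ≤ Fintype.card V) (hα : 2 * (Fintype.card V : ℝ) - 6 < α) {k : ℕ} {c : ℤ → V}
    (hc : IsoCycle s.graph k c) (h₁ : s.Buys (c 0) (c 1)) (h₂ : s.Buys (c 0) (c (-1))) :
    False := by
  have hn' : (6 : ℝ) ≤ Fintype.card V := by exact_mod_cast hn
  have hα' : (Fintype.card V : ℝ) < α := by linarith
  have hk := h.four_le hG hα' hc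
  obtain ⟨m, hm⟩ : ∃ m, m = k / 2 := ⟨_, rfl⟩
  have d1 := hc.dist_eq 0 m (by omega)
  have d2 := hc.dist_eq 0 (m + 1) (by omega)
  rw [zero_add] at d1 d2
  push_cast at d2
  have e1 : c (k - 1) = c (-1) := hc.congr_mod ⟨-1, by ring⟩
  have e2 : c k = c 0 := hc.congr_mod ⟨-1, by ring⟩
  have e3 : c (m + 1 - k) = c (m + 1) := hc.congr_mod ⟨1, by ring⟩
  have hne : c 1 ≠ c (-1) := (hc.ne (by omega) (by omega)).symm
  refine absurd ?_ (not_le.2 hα)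
  rcases hc.adj m with hb | hb
  · refine h.le_of_two_swaps hG (by linarith) hne h₁ h₂ hb (by omega) ?_ ?_ ?_
    · exact (hc.walkIn_arc (i := 1) (j := m) (a := 0) (by omega) (by omega) (by omega)
        (by omega)).symm
    · rw [← e1]
      exact hc.walkIn_arc (by omega) (by omega) (by omega) (by omega)
    · rw [← e2]
      rw [← e2] at d1 d2
      exact (hc.walkIn_arc (i := m + 1) (j := k) (a := m) (by omega) (by omega) (by omega)
        (by omega)).symm
  · rcases eq_or_lt_of_le hk with rfl | hk
    · obtain rfl : m = 2 := by omega
      have e4 : c ((2 : ℕ) + 1) = c (-1) := e1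
      rw [e4] at hb
      have := h.le_of_four_cycle hG (a := c 0) (b := c (-1)) (c := c 2) (d := c 1) h₂ hb
        (hc.adj 1).symm (hc.adj 0).symm (hc.ne (by omega) (by omega)) hne.symm
      linarith
    · refine h.le_of_two_swaps hG (by linarith) hne h₁ h₂ hb (by omega) ?_ ?_ ?_
      · exact (hc.walkIn_arc (i := 1) (j := m + 1) (a := 0) (by omega) (by omega) (by omega)
          (by omega)).symm
      · rw [← e1]
        exact hc.walkIn_arc (by omega) (by omega) (by omega) (by omega)
      · rw [← e3]
        rw [← e3] at d2
        exact hc.walkIn_arc (by omega) (by omega) (by omega) (by omega)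

/-- Isometric cycles of a stable network are directed: if an agent buys the next edge, so does
everyone on the cycle. -/
theorem Profile.IsStable.directed (h : s.IsStable α) (hG : s.graph.Connected)
    (hn : 6 ≤ Fintype.card V) (hα : 2 * (Fintype.card V : ℝ) - 6 < α) {k : ℕ} {c : ℤ → V}
    (hc : IsoCycle s.graph k c) (h₁ : s.Buys (c 0) (c 1)) (i : ℤ) :
    s.Buys (c i) (c (i + 1)) := by
  -- Ownership propagates backwards, hence by periodicity everywhere.
  have hstep : ∀ i, s.Buys (c i) (c (i + 1)) → s.Buys (c (i - 1)) (c i) := by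
    intro i hi
    have := hc.adj (i - 1)
    rw [sub_add_cancel] at this
    rcases this with hb | hb
    · exact hb
    · refine (h.not_buys_two_on_isoCycle hG hn hα (hc.shift i) ?_ ?_).elim
      · rwa [zero_add, add_comm]
      · rwa [zero_add, neg_add_eq_sub]
  have hback : ∀ n : ℕ, s.Buys (c (-n)) (c (-n + 1)) := by
    intro n
    induction n with
    | zero => simpa using h₁
    | succ n ih =>
      have := hstep _ ih
      rwa [show (-(n : ℤ)) - 1 = -((n + 1 : ℕ) : ℤ) by push_cast; ring,
        show (-(n : ℤ)) = -((n + 1 : ℕ) : ℤ) + 1 by push_cast; ring] at this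
  have hk := hc.three_le
  have hle : i ≤ |i| * k := by
    have h1 : i ≤ |i| := le_abs_self i
    have h2 : (1 : ℤ) ≤ k := by omega
    nlinarith [abs_nonneg i]
  have := hback (|i| * k - i).toNat
  have e : -(((|i| * k - i).toNat : ℕ) : ℤ) = i - |i| * k := by omega
  rw [e] at this
  rwa [hc.congr_mod (i := i) (j := i - |i| * k) ⟨-|i|, by ring⟩,
    hc.congr_mod (i := i + 1) (j := i - |i| * k + 1) ⟨-|i|, by ring⟩]

end DirectedCycles

/-! ### Biconnected components -/

section Blocks

variable {V : Type*} {G : SimpleGraph V}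

/-- Any two vertices of `K` remain joined inside `K` after the removal of a third vertex. For sets
with at least three vertices this is biconnectedness of the induced subgraph, see
`isBiconnected_induce_iff`. -/
def RobustlyJoined (G : SimpleGraph V) (K : Set V) : Prop :=
  ∀ x, ∀ y ∈ K, ∀ z ∈ K, y ≠ x → z ≠ x → ∃ l, WalkIn G (K \ {x}) l y z

theorem RobustlyJoined.pair {a b : V} (h : G.Adj a b) : RobustlyJoined G {a, b} := by
  intro x y hy z hz hyx hzx
  have hyA : y ∈ ({a, b} : Set V) \ {x} := ⟨hy, hyx⟩
  have hzA : z ∈ ({a, b} : Set V) \ {x} := ⟨hz, hzx⟩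
  by_cases hyz : y = z
  · subst hyz
    exact ⟨0, .refl hyA⟩
  refine ⟨1, .of_adj ?_ hyA hzA⟩
  rcases hy with rfl | rfl <;> rcases hz with rfl | rfl
  exacts [(hyz rfl).elim, h, h.symm, (hyz rfl).elim]

/-- Adding a path with distinct ends in `K` preserves robust joinedness: from a vertex of the path,
one of the two directions along the path leads into `K` around the removed vertex. -/
theorem RobustlyJoined.union_path {K : Set V} (hK : RobustlyJoined G K) {a b : V} (ha : a ∈ K)
    (hb : b ∈ K) {p : G.Walk a b} (hp : p.IsPath) :
    RobustlyJoined G (K ∪ {w | w ∈ p.support}) := by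
  classical
  intro x
  set A := (K ∪ {w | w ∈ p.support}) \ {x} with hA
  have key : ∀ y ∈ K ∪ {w | w ∈ p.support}, y ≠ x → ∃ w ∈ K, w ≠ x ∧ ∃ l, WalkIn G A l y w := by
    rintro y (hy | hy) hyx
    · exact ⟨y, hy, hyx, 0, .refl ⟨Or.inl hy, hyx⟩⟩
    have hy' : y ∈ p.support := hy
    by_cases h1 : x ∈ (p.takeUntil y hy').support
    · have h2 : x ∉ (p.dropUntil y hy').support := by
        intro h2
        have hnd := hp.support_nodup
        rw [← p.take_spec hy', Walk.support_append, List.nodup_append] at hnd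
        rw [← Walk.cons_tail_support, List.mem_cons] at h2
        rcases h2 with h2 | h2
        · exact hyx h2.symm
        · exact hnd.2.2 x h1 x h2 rfl
      refine ⟨b, hb, fun h => h2 (h ▸ Walk.end_mem_support _), _, p.dropUntil y hy', le_rfl,
        fun w hw => ⟨Or.inr (p.support_dropUntil_subset_support hy' hw), ?_⟩⟩
      rintro rfl
      exact h2 hw
    · refine ⟨a, ha, fun h => h1 (h ▸ Walk.start_mem_support _), _, .symm
        ⟨p.takeUntil y hy', le_rfl,
          fun w hw => ⟨Or.inr (p.support_takeUntil_subset_support hy' hw), ?_⟩⟩⟩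
      rintro rfl
      exact h1 hw
  intro y hy z hz hyx hzx
  obtain ⟨y', hy'K, hy'x, l, hl⟩ := key y hy hyx
  obtain ⟨z', hz'K, hz'x, m, hm⟩ := key z hz hzx
  obtain ⟨r, hr⟩ := hK x y' hy'K z' hz'K hy'x hz'x
  exact ⟨_, (hl.trans (hr.mono (Set.sdiff_subset_sdiff_left Set.subset_union_left) le_rfl)).trans
    hm.symm⟩

theorem WalkIn.of_induce {K : Set V} {B : Set K} {l : ℕ} {x y : K}
    (h : WalkIn (G.induce K) B l x y) : WalkIn G (Subtype.val '' B) l x y := by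
  obtain ⟨p, hp, hpB⟩ := h
  refine ⟨p.map (Embedding.induce K).toHom, (Walk.length_map _ _).trans_le hp, fun w hw => ?_⟩
  have hs := Walk.support_map (Embedding.induce K).toHom p
  obtain ⟨w', hw', rfl⟩ := List.mem_map.1 ((congrArg (w ∈ ·) hs).mp hw)
  exact ⟨w', hpB w' hw', rfl⟩

theorem IsoCycle.exists_path {k : ℕ} {c : ℤ → V} (hc : IsoCycle G k c) :
    ∃ p : G.Walk (c 1) (c 0), p.IsPath ∧ p.length + 1 = k ∧
      (∀ w, w ∈ p.support ↔ w ∈ Set.range c) ∧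
      ∀ e ∈ p.edges, ∃ i : ℤ, 1 ≤ i ∧ i < k ∧ e = s(c i, c (i + 1)) := by
  have hk := hc.three_le
  have h := hc.exists_arc (k - 1) 1 k (by omega)
  have e : c k = c 0 := hc.congr_mod ⟨-1, by ring⟩
  rw [e] at h
  obtain ⟨p, hl, hs, he, hp⟩ := h
  refine ⟨p, hp (by omega), by omega, fun w => ?_, fun e h => ?_⟩
  · rw [hs]
    constructor
    · rintro ⟨n, -, rfl⟩
      exact ⟨_, rfl⟩
    · rintro ⟨i, rfl⟩
      have h1 := Int.emod_nonneg (i - 1) (b := (k : ℤ)) (by omega)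
      have h2 := Int.emod_lt_of_pos (i - 1) (b := (k : ℤ)) (by omega)
      refine ⟨((i - 1) % k).toNat, by omega, hc.congr_mod ⟨-((i - 1) / k), ?_⟩⟩
      have := Int.emod_add_mul_ediv (i - 1) k
      rw [Int.toNat_of_nonneg h1]
      linarith
  · obtain ⟨n, hn, rfl⟩ := (he e).1 h
    exact ⟨1 + n, by omega, by omega, rfl⟩

theorem IsoCycle.robustlyJoined {k : ℕ} {c : ℤ → V} (hc : IsoCycle G k c) :
    RobustlyJoined G (Set.range c) := by
  obtain ⟨p, hp, -, hs, -⟩ := hc.exists_path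
  have h01 := hc.adj 0
  rw [zero_add] at h01
  have key := (RobustlyJoined.pair h01).union_path (by simp) (by simp) hp
  convert key using 1
  ext w
  constructor
  · exact fun hw => Or.inr ((hs w).2 hw)
  · rintro ((rfl | rfl) | hw)
    exacts [⟨_, rfl⟩, ⟨_, rfl⟩, (hs w).1 hw]

variable [Finite V]

theorem exists_mem_ne_ne {K : Set V} (hK : 3 ≤ Nat.card K) (y z : V) : ∃ x ∈ K, x ≠ y ∧ x ≠ z := by
  have h : ({y, z} : Set V).ncard < K.ncard := by
    have := Set.ncard_insert_le y {z}
    rw [Set.ncard_singleton] at this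
    have h3 : 3 ≤ K.ncard := hK
    omega
  obtain ⟨x, hx, hx'⟩ := Set.exists_mem_notMem_of_ncard_lt_ncard h
  simp only [Set.mem_insert_iff, Set.mem_singleton_iff, not_or] at hx'
  exact ⟨x, hx, hx'⟩

theorem isBiconnected_induce_iff {K : Set V} :
    IsBiconnected (G.induce K) ↔ 3 ≤ Nat.card K ∧ RobustlyJoined G K := by
  constructor
  · rintro ⟨hconn, hcard, hcut⟩
    refine ⟨hcard, fun x y hy z hz hyx hzx => ?_⟩
    by_cases hx : x ∈ K
    · have h1 := hcut ⟨x, hx⟩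
      rw [IsCutVertex, not_nontrivial_iff_subsingleton] at h1
      obtain ⟨p⟩ := ConnectedComponent.exact (h1.elim
        (connectedComponentMk _ ⟨⟨y, hy⟩, fun h => hyx (congrArg Subtype.val h)⟩)
        (connectedComponentMk _ ⟨⟨z, hz⟩, fun h => hzx (congrArg Subtype.val h)⟩))
      refine ⟨_, (WalkIn.of_induce (WalkIn.of_induce
        ⟨p, le_rfl, fun w _ => Set.mem_univ w⟩)).mono ?_ le_rfl⟩
      rintro _ ⟨_, ⟨⟨⟨w, hwK⟩, hw⟩, -, rfl⟩, rfl⟩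
      exact ⟨hwK, fun h => hw (Subtype.ext h)⟩
    · obtain ⟨p⟩ := hconn.preconnected ⟨y, hy⟩ ⟨z, hz⟩
      refine ⟨_, (WalkIn.of_induce ⟨p, le_rfl, fun w _ => Set.mem_univ w⟩).mono ?_ le_rfl⟩
      rintro _ ⟨⟨w, hwK⟩, -, rfl⟩
      exact ⟨hwK, fun h => hx (h ▸ hwK)⟩
  · rintro ⟨hcard, hK⟩
    refine ⟨?_, hcard, fun x => ?_⟩
    · obtain ⟨x₀, hx₀⟩ : Nonempty K := (Nat.card_pos_iff.1 (by omega)).1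
      have : (G.induce K).Preconnected := by
        rintro ⟨y, hy⟩ ⟨z, hz⟩
        obtain ⟨x, -, hxy, hxz⟩ := exists_mem_ne_ne hcard y z
        obtain ⟨l, p, -, hp⟩ := hK x y hy z hz hxy.symm hxz.symm
        exact ⟨p.induce K fun w hw => (hp w hw).1⟩
      exact { preconnected := this, nonempty := ⟨⟨x₀, hx₀⟩⟩ }
    · rw [IsCutVertex, not_nontrivial_iff_subsingleton]
      refine Preconnected.subsingleton_connectedComponent ?_
      obtain ⟨x, hx⟩ := x
      rintro ⟨⟨y, hy⟩, hyx⟩ ⟨⟨z, hz⟩, hzx⟩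
      obtain ⟨l, p, -, hp⟩ := hK x y hy z hz (fun h => hyx (Subtype.ext h))
        (fun h => hzx (Subtype.ext h))
      refine ⟨(p.induce K fun w hw => (hp w hw).1).induce _ ?_⟩
      rintro ⟨w, hwK⟩ hw h
      have hw' : w ∈ p.support := by
        have := List.mem_map_of_mem (f := Subtype.val) hw
        simpa using this
      exact (hp w hw').2 (congrArg Subtype.val h)

theorem exists_component_of_robustlyJoined {K : Set V} (hcard : 3 ≤ Nat.card K)
    (hK : RobustlyJoined G K) : ∃ H, K ⊆ H ∧ IsBiconnectedComponent G H := by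
  obtain ⟨H, hKH, hH⟩ := (Set.toFinite {K : Set V | IsBiconnected (G.induce K)}).exists_le_maximal
    (isBiconnected_induce_iff.2 ⟨hcard, hK⟩)
  exact ⟨H, hKH, hH⟩

theorem IsBiconnectedComponent.support_subset {H : Set V} (hH : IsBiconnectedComponent G H)
    {a b : V} (ha : a ∈ H) (hb : b ∈ H) {p : G.Walk a b} (hp : p.IsPath) {w : V}
    (hw : w ∈ p.support) : w ∈ H := by
  obtain ⟨hcard, hHr⟩ := isBiconnected_induce_iff.1 hH.prop
  have h1 : Nat.card H ≤ Nat.card (H ∪ {w | w ∈ p.support} : Set V) :=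
    Set.ncard_le_ncard Set.subset_union_left
  have h2 : IsBiconnected (G.induce (H ∪ {w | w ∈ p.support})) :=
    isBiconnected_induce_iff.2 ⟨hcard.trans h1, hHr.union_path ha hb hp⟩
  exact hH.le_of_ge h2 Set.subset_union_left (Or.inr hw)

theorem IsBiconnectedComponent.not_isBridge {H : Set V} (hH : IsBiconnectedComponent G H)
    {a b : V} (ha : a ∈ H) (hb : b ∈ H) (hab : a ≠ b) : ¬ G.IsBridge s(a, b) := by
  obtain ⟨hcard, hHr⟩ := isBiconnected_induce_iff.1 hH.prop
  obtain ⟨z, hz, hza, hzb⟩ := exists_mem_ne_ne hcard a b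
  obtain ⟨l, p, -, hp⟩ := hHr b a ha z hz hab hzb
  obtain ⟨m, q, -, hq⟩ := hHr a z hz b hb hza hab.symm
  rw [isBridge_iff_forall_walk_mem_edges]
  intro h
  have := h (p.append q)
  rw [Walk.edges_append, List.mem_append] at this
  rcases this with h | h
  · exact (hp b (p.snd_mem_support_of_mem_edges h)).2 rfl
  · exact (hq a (q.fst_mem_support_of_mem_edges h)).2 rfl

/-- A component contains every isometric cycle with which it shares an edge. -/
theorem IsBiconnectedComponent.isoCycle_mem {H : Set V} (hH : IsBiconnectedComponent G H) {k : ℕ}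
    {c : ℤ → V} (hc : IsoCycle G k c) (h0 : c 0 ∈ H) (h1 : c 1 ∈ H) (i : ℤ) : c i ∈ H := by
  obtain ⟨p, hp, -, hs, -⟩ := hc.exists_path
  exact hH.support_subset h1 h0 hp ((hs _).2 ⟨i, rfl⟩)

theorem IsoCycle.three_le_card {k : ℕ} {c : ℤ → V} (hc : IsoCycle G k c) {K : Set V}
    (hK : Set.range c ⊆ K) : 3 ≤ Nat.card K := by
  have hk := hc.three_le
  have h1 : ({c 0, c 1, c 2} : Set V).ncard = 3 :=
    Set.ncard_eq_three.2 ⟨c 0, c 1, c 2, hc.ne (by omega) (by omega), hc.ne (by omega) (by omega),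
      hc.ne (by omega) (by omega), rfl⟩
  rw [← h1]
  refine Set.ncard_le_ncard (t := K) ?_
  rintro w (rfl | rfl | rfl) <;> exact hK ⟨_, rfl⟩

end Blocks

/-! ### A cycle with everything else hanging from its vertices -/

section PendantCycles

/-- The graph `G` without the edges of the cyclic sequence `c`. -/
def offCycle {V : Type*} (G : SimpleGraph V) (c : ℤ → V) : SimpleGraph V :=
  G.deleteEdges {e | ∃ i, e = s(c i, c (i + 1))}

theorem walkIn_univ_of_adj {V : Type*} {G : SimpleGraph V} {c : ℤ → V} (t : ℕ) (i : ℤ)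
    (h : ∀ j, i ≤ j → j < i + t → G.Adj (c j) (c (j + 1))) :
    WalkIn G Set.univ t (c i) (c (i + t)) := by
  induction t with
  | zero => simpa using WalkIn.refl (G := G) (Set.mem_univ (c i))
  | succ t ih =>
    have h1 := ih fun j hj hj' => h j hj (by push_cast; omega)
    have h2 := h (i + t) (by omega) (by push_cast; omega)
    have := h1.trans (.of_adj h2 (Set.mem_univ _) (Set.mem_univ _))
    rwa [show i + t + 1 = i + ((t + 1 : ℕ) : ℤ) by push_cast; ring] at this

/-- Cyclic shifts permute the residues. -/
theorem sum_range_emod_sub {M : Type*} [AddCommMonoid M] {k : ℕ} (hk : 0 < k) (g : ℤ) (φ : ℕ → M) :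
    ∑ i ∈ Finset.range k, φ ((g - i) % k).toNat = ∑ t ∈ Finset.range k, φ t := by
  have hmod : ∀ x : ℤ, 0 ≤ x % k ∧ x % k < k := fun x =>
    ⟨Int.emod_nonneg x (by omega), Int.emod_lt_of_pos x (by omega)⟩
  have hmem : ∀ i ∈ Finset.range k, ((g - i) % k).toNat ∈ Finset.range k := fun i _ => by
    have := hmod (g - i)
    rw [Finset.mem_range]
    omega
  have hinv : ∀ i ∈ Finset.range k, ((g - (((g - i) % k).toNat : ℕ)) % k).toNat = i := fun i hi => by
    have h1 := hmod (g - i)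
    rw [Int.toNat_of_nonneg h1.1, Int.sub_emod, Int.emod_emod, ← Int.sub_emod, sub_sub_cancel,
      Int.emod_eq_of_lt (by omega) (by simpa using hi)]
    simp
  exact Finset.sum_nbij' (fun i => ((g - i) % k).toNat) (fun i => ((g - i) % k).toNat) hmem hmem
    hinv hinv fun _ _ => rfl

/-- The edges of a directed cycle that a deviation of one of its agents leaves alone. -/
theorem deviate_adj_cycle {V : Type*} [DecidableEq V] {s : Profile V} {k : ℕ} {c : ℤ → V} (hc : IsoCycle s.graph k c)
    (hdir : ∀ i, s.Buys (c i) (c (i + 1))) {i j : ℤ} {T : Finset V} (hT : c i ∉ T) (h : i < j)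
    (h' : j < i + k) : (s.deviate (c i) T hT).graph.Adj (c j) (c (j + 1)) := by
  have hne := (hc.ne h h').symm
  exact Or.inl (by simpa [Profile.Buys, Profile.deviate, Function.update_of_ne hne] using hdir j)

variable {V : Type*} [Fintype V] [DecidableEq V] {s : Profile V} {α : ℝ}

/-- Suppose that off an isometric cycle no two of its vertices are connected, so that the rest of
the network hangs from the vertices of the cycle. Let every agent of the cycle deviate in the same
way. Summed over the cycle, the change of distance costs is the same for each agent that the
distances are measured to, and only depends on the distances `φ` along the changed cycle. -/
theorem Profile.IsStable.sum_le_of_pendant (h : s.IsStable α) (hG : s.graph.Connected) (hα : 0 ≤ α)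
    {k : ℕ} {c : ℤ → V} (hc : IsoCycle s.graph k c)
    (hsep : ∀ i j, (offCycle s.graph c).Reachable (c i) (c j) → c i = c j) (r : ℕ)
    (T : ℤ → Finset V) (hT : ∀ i, c i ∉ T i) (hcard : ∀ i, (T i).card + r ≤ (s.S (c i)).card)
    (hkeep : ∀ i, (s.S (c i)).erase (c (i + 1)) ⊆ T i) (φ : ℕ → ℕ)
    (hφ : ∀ i, ∀ t < k, WalkIn (s.deviate (c i) (T i) (hT i)).graph Set.univ (φ t) (c i)
      (c (i + t))) :
    α * r * k + Fintype.card V * ∑ t ∈ Finset.range k, (min t (k - t) : ℕ) ≤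
      Fintype.card V * (∑ t ∈ Finset.range k, φ t : ℕ) := by
  have hk := hc.three_le
  set G' := offCycle s.graph c with hG'
  have hoff : ∀ x y, s.graph.Adj x y → ¬ G'.Adj x y → x ∈ Set.range c ∧ y ∈ Set.range c := by
    intro x y hxy hxy'
    by_contra hcon
    refine hxy' ((deleteEdges_adj ..).2 ⟨hxy, ?_⟩)
    rintro ⟨i, hi⟩
    rcases Sym2.eq_iff.1 hi with ⟨rfl, rfl⟩ | ⟨rfl, rfl⟩
    · exact hcon ⟨⟨_, rfl⟩, ⟨_, rfl⟩⟩
    · exact hcon ⟨⟨_, rfl⟩, ⟨_, rfl⟩⟩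
  have hle : ∀ i, G' ≤ (s.deviate (c i) (T i) (hT i)).graph := by
    intro i x y hxy
    obtain ⟨h1, h2⟩ := (deleteEdges_adj ..).1 hxy
    refine deviate_adj h1 (fun hx hy => hkeep i (Finset.mem_erase.2 ⟨?_, hy⟩))
      (fun hy hx => hkeep i (Finset.mem_erase.2 ⟨?_, hx⟩))
    · rintro rfl
      exact h2 ⟨i, by rw [hx]⟩
    · rintro rfl
      exact h2 ⟨i, by rw [hy, Sym2.eq_swap]⟩
  -- Every agent hangs from a vertex of the cycle.
  have hgate : ∀ x, ∃ j : ℤ, G'.Reachable x (c j) := by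
    intro x
    obtain ⟨p⟩ := hG.preconnected x (c 0)
    generalize hy : c 0 = y at p
    induction p with
    | nil => exact ⟨0, hy ▸ .refl _⟩
    | @cons x z _ hxz _ ih =>
      obtain ⟨j, hj⟩ := ih hy
      by_cases h' : G'.Adj x z
      · exact ⟨j, h'.reachable.trans hj⟩
      · obtain ⟨i, rfl⟩ := (hoff x z hxz h').1
        exact ⟨i, .refl _⟩
  choose g hg using hgate
  have hgc : ∀ i, c (g (c i)) = c i := fun i => (hsep _ _ (hg (c i))).symm
  set D : V → ℕ := fun x => G'.dist x (c (g x)) with hD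
  have hDc : ∀ i, D (c i) = 0 := fun i => by
    simp only [hD, hgc, SimpleGraph.dist_self]
  set τ : ℤ → V → ℕ := fun i x => ((g x - i) % k).toNat with hτ
  have hτk : ∀ i x, τ i x < k := fun i x => by
    have h1 := Int.emod_nonneg (g x - i) (b := (k : ℤ)) (by omega)
    have h2 := Int.emod_lt_of_pos (g x - i) (b := (k : ℤ)) (by omega)
    simp only [hτ]
    omega
  have hτc : ∀ i x, c (i + τ i x) = c (g x) := fun i x => by
    have h1 := Int.emod_nonneg (g x - i) (b := (k : ℤ)) (by omega)
    have h2 := Int.emod_add_mul_ediv (g x - i) k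
    refine hc.congr_mod ⟨(g x - i) / k, ?_⟩
    simp only [hτ]
    rw [Int.toNat_of_nonneg h1]
    linarith
  have hlow : ∀ i x, min (τ i x) (k - τ i x) + D x ≤ s.graph.dist (c i) x := by
    intro i x
    have key := le_add_dist_of_lipschitz hG (fun z => s.graph.dist (c i) (c (g z)) + D z)
      (fun x y hxy => by
        by_cases h' : G'.Adj x y
        · have h1 : c (g x) = c (g y) :=
            hsep _ _ ((hg x).symm.trans (h'.reachable.trans (hg y)))
          have h2 := h'.symm.reachable.dist_triangle_left (c (g x))
          rw [dist_eq_one_iff_adj.2 h'.symm] at h2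
          simp only [hD]
          rw [h1] at h2 ⊢
          omega
        · obtain ⟨⟨a, rfl⟩, ⟨b, rfl⟩⟩ := hoff x y hxy h'
          have h1 := hG.dist_triangle (u := c i) (v := c a) (w := c b)
          rw [dist_eq_one_iff_adj.2 hxy] at h1
          simp only [hgc, hDc]
          omega) (c i) x
    have h1 := hc.dist_eq i (τ i x) (hτk i x).le
    rw [hτc] at h1
    simp only [hgc, hDc, h1, SimpleGraph.dist_self] at key
    omega
  have hone : ∀ i : ℤ, α * r + ∑ x, ((min (τ i x) (k - τ i x) : ℕ) : ℝ) ≤ ∑ x, (φ (τ i x) : ℝ) := by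
    intro i
    have key := h.cost_le hG (c i) (T i) (hT i) (fun x => φ (τ i x) + D x) fun x => by
      have h1 := hφ i (τ i x) (hτk i x)
      rw [hτc] at h1
      obtain ⟨p, hp⟩ := (hg x).symm.exists_walk_length_eq_dist
      refine h1.trans ⟨p.mapLe (hle i), ?_, by simp⟩
      rw [Walk.length_map, hp, dist_comm]
    have h2 : ∑ x, (((min (τ i x) (k - τ i x) : ℕ) : ℝ) + D x) ≤
        ∑ x, (s.graph.dist (c i) x : ℝ) :=
      Finset.sum_le_sum fun x _ => by exact_mod_cast hlow i x
    have h3 : α * ((T i).card + r) ≤ α * (s.S (c i)).card :=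
      mul_le_mul_of_nonneg_left (by exact_mod_cast hcard i) hα
    simp only [Nat.cast_add] at key
    rw [Finset.sum_add_distrib] at h2 key
    linarith
  have hall := Finset.sum_le_sum fun (i : ℕ) (_ : i ∈ Finset.range k) => hone i
  have hre : ∀ ψ : ℕ → ℕ, ∑ i ∈ Finset.range k, ∑ x, (ψ (τ i x) : ℝ) =
      Fintype.card V * (∑ t ∈ Finset.range k, ψ t : ℕ) := by
    intro ψ
    rw [Finset.sum_comm]
    have : ∀ x ∈ Finset.univ, ∑ i ∈ Finset.range k, (ψ (τ i x) : ℝ) =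
        (∑ t ∈ Finset.range k, ψ t : ℕ) := fun x _ => by
      rw [Nat.cast_sum]
      exact sum_range_emod_sub (by omega) (g x) fun t => (ψ t : ℝ)
    rw [Finset.sum_congr rfl this, Finset.sum_const, Finset.card_univ, nsmul_eq_mul]
  rw [Finset.sum_add_distrib, hre φ, hre fun t => min t (k - t)] at hall
  simp only [Finset.sum_const, Finset.card_range, nsmul_eq_mul] at hall
  linarith

/-- The rest of the network cannot just hang from the vertices of a directed isometric cycle: a
short cycle would be opened by one of its agents, and on a long cycle some agent would gain by
moving her edge one vertex ahead. -/
theorem Profile.IsStable.exists_reachable_offCycle (h : s.IsStable α) (hG : s.graph.Connected)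
    (hα : Fintype.card V < α) {k : ℕ} {c : ℤ → V} (hc : IsoCycle s.graph k c)
    (hdir : ∀ i, s.Buys (c i) (c (i + 1))) :
    ∃ i j, c i ≠ c j ∧ (offCycle s.graph c).Reachable (c i) (c j) := by
  by_contra hcon
  have hsep : ∀ i j, (offCycle s.graph c).Reachable (c i) (c j) → c i = c j := fun i j hij => by
    by_contra hne
    exact hcon ⟨i, j, hne, hij⟩
  have hk := hc.three_le
  have hV : 0 < Fintype.card V := Fintype.card_pos_iff.2 ⟨c 0⟩
  have hV' : (0 : ℝ) < Fintype.card V := by exact_mod_cast hV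
  rcases lt_or_ge k 6 with hk6 | hk6
  · have hT : ∀ i, c i ∉ (s.S (c i)).erase (c (i + 1)) := fun i hi =>
      s.notMem_self _ (Finset.mem_of_mem_erase hi)
    have key := h.sum_le_of_pendant hG (by linarith) hc hsep 1 _ hT
      (fun i => (Finset.card_erase_add_one (hdir i)).le) (fun i => subset_rfl)
      (fun t => if t = 0 then 0 else k - t) fun i t ht => by
        by_cases ht0 : t = 0
        · subst ht0
          simpa using WalkIn.refl (Set.mem_univ (c i))
        rw [if_neg ht0]
        have := walkIn_univ_of_adj (c := c) (k - t) (i + t) fun j hj hj' =>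
          deviate_adj_cycle hc hdir (hT i) (by omega) (by omega)
        rw [show i + t + ((k - t : ℕ) : ℤ) = i + k by omega, hc.periodic] at this
        exact this.symm
    interval_cases k <;> simp [Finset.sum_range_succ] at key <;> linarith
  · have hT : ∀ i, c i ∉ insert (c (i + 2)) ((s.S (c i)).erase (c (i + 1))) := by
      intro i hi
      rcases Finset.mem_insert.1 hi with hi | hi
      · exact hc.ne (by omega) (by omega) hi
      · exact s.notMem_self _ (Finset.mem_of_mem_erase hi)
    have key := h.sum_le_of_pendant hG (by linarith) hc hsep 0 _ hT
      (fun i => by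
        have h1 := Finset.card_erase_add_one (hdir i)
        have h2 := Finset.card_insert_le (c (i + 2)) ((s.S (c i)).erase (c (i + 1)))
        omega)
      (fun i => Finset.subset_insert _ _)
      (fun t => if t = 0 then 0 else if t = 1 then 2 else min (t - 1) (k - t)) fun i t ht => by
        have h2 : (s.deviate (c i) _ (hT i)).graph.Adj (c i) (c (i + 2)) :=
          deviate_adj_of_mem (Finset.mem_insert_self _ _)
        have h2' := WalkIn.of_adj h2 (Set.mem_univ _) (Set.mem_univ _)
        by_cases ht0 : t = 0
        · subst ht0
          simpa using WalkIn.refl (Set.mem_univ (c i))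
        by_cases ht1 : t = 1
        · subst ht1
          have h3 : (s.deviate (c i) _ (hT i)).graph.Adj (c (i + 1)) (c (i + 1 + 1)) :=
            deviate_adj_cycle hc hdir _ (by omega) (by omega)
          rw [add_assoc] at h3
          simpa using h2'.trans (.of_adj h3.symm (Set.mem_univ _) (Set.mem_univ _))
        rw [if_neg ht0, if_neg ht1]
        rcases le_total (t - 1) (k - t) with hle | hle
        · rw [min_eq_left hle]
          have := walkIn_univ_of_adj (c := c) (t - 2) (i + 2) fun j hj hj' =>
            deviate_adj_cycle hc hdir (hT i) (by omega) (by omega)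
          rw [show i + 2 + ((t - 2 : ℕ) : ℤ) = i + t by omega] at this
          exact (h2'.trans this).mono subset_rfl (by omega)
        · rw [min_eq_right hle]
          have := walkIn_univ_of_adj (c := c) (k - t) (i + t) fun j hj hj' =>
            deviate_adj_cycle hc hdir (hT i) (by omega) (by omega)
          rw [show i + t + ((k - t : ℕ) : ℤ) = i + k by omega, hc.periodic] at this
          exact this.symm
    -- The gain of one on the positions `2` and `3` outweighs the loss of one on the position `1`.
    have hsum : ∑ t ∈ Finset.range k,
        ((if t = 0 then 0 else if t = 1 then 2 else min (t - 1) (k - t)) +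
          ((if t = 2 then 1 else 0) + if t = 3 then 1 else 0)) ≤
        ∑ t ∈ Finset.range k, (min t (k - t) + if t = 1 then 1 else 0) := by
      refine Finset.sum_le_sum fun t ht => ?_
      have := Finset.mem_range.1 ht
      split_ifs <;> omega
    simp only [Finset.sum_add_distrib, Finset.sum_ite_eq', Finset.mem_range] at hsum
    rw [if_pos (by omega), if_pos (by omega), if_pos (by omega)] at hsum
    have hlt : ((∑ t ∈ Finset.range k,
        if t = 0 then 0 else if t = 1 then 2 else min (t - 1) (k - t) : ℕ) : ℝ) + 1 ≤
        (∑ t ∈ Finset.range k, min t (k - t) : ℕ) := by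
      exact_mod_cast (by omega)
    have := mul_le_mul_of_nonneg_left hlt hV'.le
    simp only [Nat.cast_zero, mul_zero, zero_mul, zero_add] at key
    linarith

end PendantCycles

/-! ### Critical pairs -/

section CriticalPairs

variable {V : Type*} [Fintype V] [DecidableEq V] {s : Profile V} {α : ℝ}

/-- Some agent buys two edges inside of one biconnected component. A directed isometric cycle has
an ear, and an ear has fewer interior vertices than edges, so that an interior vertex buys two edges
of the ear or an end buys one in addition to her edge on the cycle. -/
theorem Profile.IsStable.exists_buys_two_in_component (h : s.IsStable α) (hG : s.graph.Connected)
    (hα : Fintype.card V < α) {k : ℕ} {c : ℤ → V} (hc : IsoCycle s.graph k c)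
    (hdir : ∀ i, s.Buys (c i) (c (i + 1))) :
    ∃ (H : Set V) (v x y : V), IsBiconnectedComponent s.graph H ∧ v ∈ H ∧ x ∈ H ∧ y ∈ H ∧ x ≠ y ∧
      s.Buys v x ∧ s.Buys v y := by
  obtain ⟨i, j, hij, ⟨q₀⟩⟩ := h.exists_reachable_offCycle hG hα hc hdir
  obtain ⟨q, hq⟩ : ∃ q : (offCycle s.graph c).Walk (c i) (c j), q.IsPath :=
    ⟨q₀.bypass, q₀.bypass_isPath⟩
  have hle : offCycle s.graph c ≤ s.graph := deleteEdges_le _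
  have hoff : ∀ a x, (offCycle s.graph c).Adj (c a) x → x ≠ c (a + 1) := by
    rintro a x hax rfl
    exact ((deleteEdges_adj ..).1 hax).2 ⟨a, rfl⟩
  have hK := hc.robustlyJoined.union_path ⟨i, rfl⟩ ⟨j, rfl⟩
    ((Walk.isPath_mapLe hle).2 hq)
  obtain ⟨H, hKH, hH⟩ :=
    exists_component_of_robustlyJoined (hc.three_le_card Set.subset_union_left) hK
  have hcH : ∀ a, c a ∈ H := fun a => hKH (Or.inl ⟨a, rfl⟩)
  have hqH : ∀ n, q.getVert n ∈ H := fun n => hKH (Or.inr (by simp))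
  have hL : 0 < q.length := by
    rw [Nat.pos_iff_ne_zero]
    exact fun h0 => hij (Walk.eq_of_length_eq_zero h0)
  have hbuy : ∀ n < q.length, s.Buys (q.getVert n) (q.getVert (n + 1)) ∨
      s.Buys (q.getVert (n + 1)) (q.getVert n) := fun n hn => hle (q.adj_getVert_succ hn)
  by_cases hfirst : s.Buys (q.getVert 0) (q.getVert 1)
  · have hadj := q.adj_getVert_succ hL
    rw [q.getVert_zero] at hfirst hadj
    exact ⟨H, c i, _, _, hH, hcH _, hqH 1, hcH _, hoff i _ hadj, hfirst, hdir i⟩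
  by_cases hturn : ∃ n, n + 1 < q.length ∧ s.Buys (q.getVert (n + 1)) (q.getVert n) ∧
      s.Buys (q.getVert (n + 1)) (q.getVert (n + 2))
  · obtain ⟨n, hn, h1, h2⟩ := hturn
    refine ⟨H, _, _, _, hH, hqH _, hqH _, hqH _, fun he => ?_, h1, h2⟩
    have := hq.getVert_injOn (by simp; omega) (by simp; omega) he
    omega
  -- Without a turn, all edges of the ear are bought in the same direction.
  have hback : ∀ n < q.length, s.Buys (q.getVert (n + 1)) (q.getVert n) := by
    intro n
    induction n with
    | zero => exact fun hn => (hbuy 0 hn).resolve_left hfirst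
    | succ n ih =>
      intro hn
      exact (hbuy (n + 1) hn).resolve_left fun hb =>
        hturn ⟨n, hn, ih (by omega), hb⟩
  obtain ⟨l, hl⟩ : ∃ l, q.length = l + 1 := ⟨q.length - 1, by omega⟩
  have hlast := hback l (by omega)
  have hadj := q.adj_getVert_succ (i := l) (by omega)
  rw [← hl, q.getVert_length] at hlast hadj
  exact ⟨H, c j, _, _, hH, hcH _, hqH l, hcH _, hoff j _ hadj.symm, hlast, hdir j⟩

/-- An agent with two edges on isometric cycles of the same component forms a critical pair with
the agent opposite to her on the longer cycle, and the shorter cycle contains a path that replaces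
her other edge. -/
theorem Profile.IsStable.exists_isCriticalPair (h : s.IsStable α) (hG : s.graph.Connected)
    (hn : 6 ≤ Fintype.card V) (hα : 2 * (Fintype.card V : ℝ) - 6 < α) (htree : ¬ s.graph.IsTree)
    {H : Set V} (hH : IsBiconnectedComponent s.graph H) {k₁ k₂ : ℕ} {c₁ c₂ : ℤ → V}
    (hc₁ : IsoCycle s.graph k₁ c₁) (hc₂ : IsoCycle s.graph k₂ c₂) (hk : k₂ ≤ k₁)
    (h0 : c₂ 0 = c₁ 0) (hne : c₁ 1 ≠ c₂ 1) (hvH : c₁ 0 ∈ H) (h₁H : c₁ 1 ∈ H) (h₂H : c₂ 1 ∈ H)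
    (hb₁ : s.Buys (c₁ 0) (c₁ 1)) (hb₂ : s.Buys (c₁ 0) (c₂ 1)) :
    ∃ (H : Set V) (v u v₁ v₂ u' : V), IsCriticalPair s H v u v₁ v₂ u' ∧
      ∃ P : s.graph.Walk v v₂, P.IsPath ∧ P.length ≤ 2 * s.graph.dist u v ∧
        s(v, v₁) ∉ P.edges ∧ s(v, v₂) ∉ P.edges := by
  have hn' : (6 : ℝ) ≤ Fintype.card V := by exact_mod_cast hn
  have hdir₁ := h.directed hG hn hα hc₁ hb₁
  have hdir₂ := h.directed hG hn hα hc₂ (h0 ▸ hb₂)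
  have hk4 := h.four_le hG (by linarith) hc₁
  have hk3 := hc₂.three_le
  obtain ⟨m, hm⟩ : ∃ m, m = k₁ / 2 := ⟨_, rfl⟩
  have d₁ := hc₁.dist_eq 0 m (by omega)
  have d₂ := hc₁.dist_eq 0 (m + 1) (by omega)
  rw [zero_add] at d₁ d₂
  push_cast at d₂
  have hHc := hH.isoCycle_mem hc₁ hvH h₁H
  obtain ⟨p, hp, hpl, -, hpe⟩ := hc₂.exists_path
  refine ⟨H, c₁ 0, c₁ m, c₁ 1, c₂ 1, c₁ (m + 1), ?_, ?_⟩
  · refine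
      { not_isTree := htree
        component := hH
        v_mem := hvH
        v₁_mem := h₁H
        v₂_mem := h₂H
        v₁_ne_v₂ := hne
        buys_v₁ := hb₁
        buys_v₂ := hb₂
        not_isBridge_v₁ := hH.not_isBridge hvH h₁H fun e => s.notMem_self _ (e ▸ hb₁)
        not_isBridge_v₂ := hH.not_isBridge hvH h₂H fun e => s.notMem_self _ (e ▸ hb₂)
        u_mem := hHc _
        u_ne_v := (hc₁.ne (by omega) (by omega)).symm
        u'_mem := hHc _
        buys_u' := hdir₁ m
        u'_ne_v := (hc₁.ne (by omega) (by omega)).symm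
        two_le_dist := by omega
        path_u := ?_
        path_u' := ?_ }
    · obtain ⟨r, hr, -, hre, -⟩ := hc₁.exists_arc m 0 m (by omega)
      have hr' : r.length = s.graph.dist (c₁ 0) (c₁ m) := by omega
      exact ⟨r, ⟨r.isPath_of_length_eq_dist hr', hr'⟩, (hre _).2 ⟨0, by omega, by simp⟩⟩
    · have hwalk := hc₁.walkIn_arc (i := m + 1) (j := k₁) (a := m) (l := k₁ - (m + 1)) (by omega)
        (by omega) (by omega) (by omega)
      rw [hc₁.congr_mod (i := k₁) (j := 0) ⟨-1, by ring⟩] at hwalk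
      obtain ⟨r, hr, hrA⟩ := hwalk.symm
      have hr' : r.length = s.graph.dist (c₁ 0) (c₁ (m + 1)) :=
        le_antisymm (by omega) (SimpleGraph.dist_le r)
      exact ⟨r, ⟨r.isPath_of_length_eq_dist hr', hr'⟩,
        fun he => hrA _ (r.fst_mem_support_of_mem_edges he) rfl⟩
  · rw [← h0, dist_comm]
    rw [← h0] at d₁ hb₁ hb₂
    refine ⟨p.reverse, hp.reverse, ?_, fun he => ?_, fun he => ?_⟩
    · rw [Walk.length_reverse]
      omega
    · rw [Walk.edges_reverse, List.mem_reverse] at he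
      obtain ⟨i, hi, hi', he⟩ := hpe _ he
      rcases Sym2.eq_iff.1 he with ⟨he1, he2⟩ | ⟨he1, he2⟩
      · exact hc₂.ne (by omega) (by omega) he1
      · -- The edge of the shorter cycle towards `v` is bought by its other end.
        refine h.not_buys_both hG (by linarith) hb₁ ?_
        rw [he1, he2]
        exact hdir₂ i
    · rw [Walk.edges_reverse, List.mem_reverse] at he
      obtain ⟨i, hi, hi', he⟩ := hpe _ he
      rcases Sym2.eq_iff.1 he with ⟨he1, he2⟩ | ⟨he1, he2⟩
      · exact hc₂.ne (by omega) (by omega) he1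
      · have e1 := hc₂.eq_iff.1 he1
        have e2 := hc₂.eq_iff.1 he2
        have := Int.le_of_dvd (by omega) (dvd_sub e1 e2)
        omega

end CriticalPairs

end NetworkCreation

theorem mainTheorem5 {V : Type*} [Fintype V] [DecidableEq V] (hn : 6 ≤ Fintype.card V)
    (α : ℝ) (hα : 2 * (Fintype.card V : ℝ) - 6 < α) (s : NetworkCreation.Profile V)
    (hstable : s.IsStable α) (htree : ¬ s.graph.IsTree) :
    ∃ (H : Set V) (v u v₁ v₂ u' : V), NetworkCreation.IsCriticalPair s H v u v₁ v₂ u' ∧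
      ∃ P : s.graph.Walk v v₂, P.IsPath ∧ P.length ≤ 2 * s.graph.dist u v ∧
        s(v, v₁) ∉ P.edges ∧ s(v, v₂) ∉ P.edges := by
  have hn' : (6 : ℝ) ≤ Fintype.card V := by exact_mod_cast hn
  have hα' : (Fintype.card V : ℝ) < α := by linarith
  have : Nonempty V := Fintype.card_pos_iff.1 (by omega)
  have hG := hstable.connected
  obtain ⟨a, b, hab, hbr⟩ : ∃ a b, s.graph.Adj a b ∧ ¬ s.graph.IsBridge s(a, b) := by
    by_contra hcon
    push Not at hcon
    exact htree ⟨hG, SimpleGraph.isAcyclic_iff_forall_adj_isBridge.2 hcon⟩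
  -- Orient the edge from its buyer.
  obtain ⟨a, b, hab, hbr⟩ : ∃ a b, s.Buys a b ∧ ¬ s.graph.IsBridge s(a, b) := by
    rcases hab with hab | hab
    · exact ⟨a, b, hab, hbr⟩
    · exact ⟨b, a, hab, by rwa [Sym2.eq_swap]⟩
  obtain ⟨k, c, hc, rfl, rfl⟩ := NetworkCreation.exists_isoCycle hG (Or.inl hab) hbr
  obtain ⟨H, v, x, y, hH, hv, hx, hy, hxy, hvx, hvy⟩ :=
    hstable.exists_buys_two_in_component hG hα' hc (hstable.directed hG hn hα hc hab)
  obtain ⟨k₁, c₁, hc₁, rfl, rfl⟩ := NetworkCreation.exists_isoCycle hG (Or.inl hvx)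
    (hH.not_isBridge hv hx fun e => s.notMem_self _ (e ▸ hvx))
  obtain ⟨k₂, c₂, hc₂, h0, rfl⟩ := NetworkCreation.exists_isoCycle hG (Or.inl hvy)
    (hH.not_isBridge hv hy fun e => s.notMem_self _ (e ▸ hvy))
  rcases le_total k₂ k₁ with hk | hk
  · exact hstable.exists_isCriticalPair hG hn hα htree hH hc₁ hc₂ hk h0 hxy hv hx hy hvx hvy
  · rw [← h0] at hv hvx hvy
    exact hstable.exists_isCriticalPair hG hn hα htree hH hc₂ hc₁ hk h0.symm hxy.symm hv hy hx hvy
      hvx
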